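/- **Theorem 1.** Consider CCS$^!$ over arbitrary sets $\mathcal A$ of names, $\mathcal K$ of agent identifiers (each $A\in\mathcal K$ with a defining equation $A\stackrel{def}{=}P_A$, where $P_A$ is a CCS$^!$ expression) and $\mathcal O$ of output actions. Let $\mathcal H=\mathcal A\uplus\bar{\mathcal A}$ be the set of handshake actions, with $\bar{\bar a}=a$, and $Act=\mathcal H\uplus\mathcal O\uplus\{\tau\}$. A relabelling is a map $f:\mathcal H\to\mathcal H$ with $f(\bar a)=\overline{f(a)}$, extended to $Act$ as the identity on $\mathcal O\cup\{\tau\}$. Expressions are built from agent identifiers $A$, prefixing $\alpha.P$ ($\alpha\in Act$), choice $\sum_{i\in I}P_i$ ($I$ any index set), parallel composition $P|Q$, restriction $P\backslash c$ ($c\in\mathcal H$) and relabelling $P[f]$. The transitions are those derivable from the rules: $\alpha.P\xrightarrow{\alpha}P$; if $P_j\xrightarrow{\alpha}P'$ for some $j\in I$ then $\sum_{i\in I}P_i\xrightarrow{\alpha}P'$; if $P\xrightarrow{\alpha}P'$ then $P|Q\xrightarrow{\alpha}P'|Q$ and $Q|P\xrightarrow{\alpha}Q|P'$; if $P\xrightarrow{c}P'$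 and $Q\xrightarrow{\bar c}Q'$ with $c\in\mathcal H$ then $P|Q\xrightarrow{\tau}P'|Q'$; if $P\xrightarrow{\alpha}P'$ and $c\ne\alpha\ne\bar c$ then $P\backslash c\xrightarrow{\alpha}P'\backslash c$; if $P\xrightarrow{\alpha}P'$ then $P[f]\xrightarrow{f(\alpha)}P'[f]$; if $P_A\xrightarrow{\alpha}P'$ then $A\xrightarrow{\alpha}P'$. A path of $P$ is a finite or infinite alternating sequence of states and transitions that starts in $P$ and, if finite, ends in a state. A decomposition of a path of $P|Q$ into a path of $P$ and a path of $Q$ is obtained by splitting each of its transitions into the transition(s) of the left and/or right component from which it derives by one of the three rules for $|$, and concatenating all left-projections and all right-projections, respectively; decompositions of paths of $P\backslash c$ and of $P[f]$ into a path of $P$ are defined likewise. *$Y$-justness*, for $Y\subseteq\mathcal H$, is the largest family of predicates on paths such that * a finite $Y$-just path ends in a state that admits actions from $Y$ only; * a $Y$-just path of $P|Q$ can be decomposed into an $X$-just path of $P$ and a $Z$-just path of $Q$ for some $X,Z\subseteq\mathcal H$ with $X\cup Z\subseteq Y$ and $X\cap\{\bar c\mid c\in Z\}=\emptyset$; * a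 $Y$-just path of $P\backslash c$ can be decomposed into a $(Y\cup\{c,\bar c\})$-just path of $P$; * a $Y$-just path of $P[f]$ can be decomposed into an $f^{-1}(Y)$-just path of $P$; * each suffix of a $Y$-just path is $Y$-just. A path is *just* (equivalently, *complete*) if it is $Y$-just for some $Y\subseteq\mathcal H$, and it is *$a$-enabled*, for $a\in\mathcal H$, if $a\in Y$ for every $Y$ for which it is $Y$-just. Let $r_1\neq r_2$ be handshake actions and $t_1,t_2,e$ output actions. Then there is no CCS$^!$ expression $F$ such that, for all $i,j\in\{1,2\}$: 1. every complete path of $F$ with finitely many occurrences of $r_i$ is $r_i$-enabled; 2. on every complete (= just) path of $F$, each occurrence of $r_i$ is followed by an occurrence of $t_i$; 3. on every finite path of $F$ there are no more occurrences of $t_i$ than of $r_i$; 4. on every path of $F$, between any two occurrences of $t_i$ and $t_j$ there is an occurrence of $e$. -/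

import Mathlib

universe u w x v

namespace CCS

/-- Handshake actions over the set `A` of names: names and co-names (disjoint union). -/
inductive Handshake (A : Type u) : Type u
  | name (a : A) : Handshake A
  | coname (a : A) : Handshake A

namespace Handshake

/-- Complementation of handshake actions. -/
def bar {A : Type u} : Handshake A → Handshake A
  | name a => coname a
  | coname a => name a

end Handshake

/-- Actions: handshake actions, output actions (from the set `O`) and the internal action. -/
inductive Act (A : Type u) (O : Type x) : Type (max u x)
  | hs (c : Handshake A) : Act A O
  | out (o : O) : Act A O
  | tau : Act A O

/-- A relabelling: a function on handshake actions that commutes with complementation. -/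
structure Relabelling (A : Type u) : Type u where
  toFun : Handshake A → Handshake A
  map_bar : ∀ c, toFun c.bar = (toFun c).bar

/-- The extension of a relabelling to all actions; it fixes output actions and `tau`. -/
def Relabelling.onAct {A : Type u} {O : Type x} (f : Relabelling A) : Act A O → Act A O
  | .hs c => .hs (f.toFun c)
  | .out o => .out o
  | .tau => .tau

/-- CCS expressions with output actions, over names `A`, agent identifiers `K` and output
actions `O`. Choice is over arbitrary index sets (the types of an arbitrary universe). -/
inductive Expr (A : Type u) (K : Type w) (O : Type x) : Type (max u w x (v + 1))
  | ident (X : K) : Expr A K O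
  | pre (α : Act A O) (P : Expr A K O) : Expr A K O
  | choice (I : Type v) (P : I → Expr A K O) : Expr A K O
  | par (P Q : Expr A K O) : Expr A K O
  | restrict (P : Expr A K O) (c : Handshake A) : Expr A K O
  | relabel (P : Expr A K O) (f : Relabelling A) : Expr A K O

variable {A : Type u} {K : Type w} {O : Type x}

/-- The labelled transition relation; `D X` is the right-hand side of the defining equation of
the agent identifier `X`. -/
inductive Step (D : K → Expr.{u, w, x, v} A K O) :
    Expr.{u, w, x, v} A K O → Act A O → Expr.{u, w, x, v} A K O → Prop
  | pre (α : Act A O) (P : Expr A K O) : Step D (.pre α P) α P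
  | choice {I : Type v} {P : I → Expr A K O} {α : Act A O} {P' : Expr A K O} (j : I) :
      Step D (P j) α P' → Step D (.choice I P) α P'
  | parLeft {P P' Q : Expr A K O} {α : Act A O} :
      Step D P α P' → Step D (.par P Q) α (.par P' Q)
  | parSync {P P' Q Q' : Expr A K O} {c : Handshake A} :
      Step D P (.hs c) P' → Step D Q (.hs c.bar) Q' → Step D (.par P Q) .tau (.par P' Q')
  | parRight {P Q Q' : Expr A K O} {α : Act A O} :
      Step D Q α Q' → Step D (.par P Q) α (.par P Q')
  | restrict {P P' : Expr A K O} {α : Act A O} {c : Handshake A} :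
      Step D P α P' → α ≠ .hs c → α ≠ .hs c.bar → Step D (.restrict P c) α (.restrict P' c)
  | relabel {P P' : Expr A K O} {α : Act A O} {f : Relabelling A} :
      Step D P α P' → Step D (.relabel P f) (f.onAct α) (.relabel P' f)
  | ident {X : K} {α : Act A O} {P' : Expr A K O} :
      Step D (D X) α P' → Step D (.ident X) α P'

/-- A finite or infinite path
`state 0 --label 0--> state 1 --label 1--> state 2 ...` with `len` many transitions.
States with index above `len` and labels with index at least `len` are not part of the path;
no definition below depends on them. -/
structure Path (D : K → Expr.{u, w, x, v} A K O) : Type (max u w x (v + 1)) where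
  len : ℕ∞
  state : ℕ → Expr.{u, w, x, v} A K O
  label : ℕ → Act A O
  step : ∀ n : ℕ, (n : ℕ∞) < len → Step D (state n) (label n) (state (n + 1))

namespace Path

variable {D : K → Expr.{u, w, x, v} A K O}

/-- `η` is a path of the process `P`, i.e. it starts in `P`. -/
def IsPathOf (η : Path D) (P : Expr.{u, w, x, v} A K O) : Prop := η.state 0 = P

/-- The `n`-th transition of `η` exists and is labelled `α`. -/
def OccursAt (η : Path D) (α : Act A O) (n : ℕ) : Prop := (n : ℕ∞) < η.len ∧ η.label n = α

/-- The suffix of `η` starting at its state number `k` (meant for `k ≤ η.len`). -/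
def suffix (η : Path D) (k : ℕ) : Path D where
  len := η.len - k
  state n := η.state (k + n)
  label n := η.label (k + n)
  step n hn := by
    have h : ((k + n : ℕ) : ℕ∞) < η.len := by
      have := lt_tsub_iff_left.mp hn
      push_cast
      exact this
    exact η.step (k + n) h

/-- `η`, a path of a parallel composition, decomposes into the path `η₁` of its left component
and the path `η₂` of its right component: each transition of `η` is a move of the left
component only, of the right component only, or a synchronisation, and `η₁` and `η₂` consist of
exactly the left- and right-projections. Here `a n` and `b n` are the numbers of left- and
right-projections of the first `n` transitions of `η`. -/
def DecomposesPar (η η₁ η₂ : Path D) : Prop :=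
  ∃ a b : ℕ → ℕ, a 0 = 0 ∧ b 0 = 0 ∧
    (∀ n : ℕ, (n : ℕ∞) ≤ η.len → η.state n = .par (η₁.state (a n)) (η₂.state (b n))) ∧
    (∀ n : ℕ, (n : ℕ∞) < η.len →
      (a (n + 1) = a n + 1 ∧ b (n + 1) = b n ∧ η.label n = η₁.label (a n)) ∨
      (a (n + 1) = a n ∧ b (n + 1) = b n + 1 ∧ η.label n = η₂.label (b n)) ∨
      (a (n + 1) = a n + 1 ∧ b (n + 1) = b n + 1 ∧ η.label n = .tau ∧
        ∃ c : Handshake A, η₁.label (a n) = .hs c ∧ η₂.label (b n) = .hs c.bar)) ∧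
    η₁.len = (⨆ (n : ℕ) (_ : (n : ℕ∞) ≤ η.len), (a n : ℕ∞)) ∧
    η₂.len = (⨆ (n : ℕ) (_ : (n : ℕ∞) ≤ η.len), (b n : ℕ∞))

/-- `η`, a path of a restriction by `c`, decomposes into the path `η'` of its argument. -/
def DecomposesRestrict (c : Handshake A) (η η' : Path D) : Prop :=
  η'.len = η.len ∧
    (∀ n : ℕ, (n : ℕ∞) ≤ η.len → η.state n = .restrict (η'.state n) c) ∧
    (∀ n : ℕ, (n : ℕ∞) < η.len → η.label n = η'.label n)

/-- `η`, a path of a relabelling by `f`, decomposes into the path `η'` of its argument. -/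
def DecomposesRelabel (f : Relabelling A) (η η' : Path D) : Prop :=
  η'.len = η.len ∧
    (∀ n : ℕ, (n : ℕ∞) ≤ η.len → η.state n = .relabel (η'.state n) f) ∧
    (∀ n : ℕ, (n : ℕ∞) < η.len → η.label n = f.onAct (η'.label n))

end Path

/-- The closure conditions on a family `J` of predicates on paths, indexed by sets of handshake
actions, of which `Y`-justness is the largest solution. -/
structure IsJustFamily (D : K → Expr.{u, w, x, v} A K O)
    (J : Set (Handshake A) → Path D → Prop) : Prop where
  finite : ∀ (Y : Set (Handshake A)) (η : Path D), J Y η → ∀ n : ℕ, η.len = n →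
    ∀ (α : Act A O) (Q : Expr A K O), Step D (η.state n) α Q → ∃ c ∈ Y, α = .hs c
  par : ∀ (Y : Set (Handshake A)) (η : Path D), J Y η → ∀ P Q : Expr A K O,
    η.IsPathOf (.par P Q) → ∃ (X Z : Set (Handshake A)) (η₁ η₂ : Path D),
      η₁.IsPathOf P ∧ η₂.IsPathOf Q ∧ η.DecomposesPar η₁ η₂ ∧ J X η₁ ∧ J Z η₂ ∧
        X ∪ Z ⊆ Y ∧ X ∩ (Handshake.bar '' Z) = ∅
  restrict : ∀ (Y : Set (Handshake A)) (η : Path D), J Y η →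
    ∀ (P : Expr A K O) (c : Handshake A), η.IsPathOf (.restrict P c) →
      ∃ η' : Path D, η'.IsPathOf P ∧ η.DecomposesRestrict c η' ∧ J (Y ∪ {c, c.bar}) η'
  relabel : ∀ (Y : Set (Handshake A)) (η : Path D), J Y η →
    ∀ (P : Expr A K O) (f : Relabelling A), η.IsPathOf (.relabel P f) →
      ∃ η' : Path D, η'.IsPathOf P ∧ η.DecomposesRelabel f η' ∧ J (f.toFun ⁻¹' Y) η'
  suffix : ∀ (Y : Set (Handshake A)) (η : Path D), J Y η →
    ∀ k : ℕ, (k : ℕ∞) ≤ η.len → J Y (η.suffix k)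

namespace Path

variable {D : K → Expr.{u, w, x, v} A K O}

/-- `Y`-justness: the union of all families satisfying the closure conditions, which is the
largest such family (see `isJustFamily_justFor`). -/
def JustFor (Y : Set (Handshake A)) (η : Path D) : Prop :=
  ∃ J : Set (Handshake A) → Path D → Prop, IsJustFamily D J ∧ J Y η

theorem isJustFamily_justFor : IsJustFamily D (JustFor (D := D)) where
  finite := fun Y η ⟨_, hJ, h⟩ => hJ.finite Y η h
  par := fun Y η ⟨J, hJ, h⟩ P Q hη => by
    obtain ⟨X, Z, η₁, η₂, h1, h2, hd, hX, hZ, hs⟩ := hJ.par Y η h P Q hη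
    exact ⟨X, Z, η₁, η₂, h1, h2, hd, ⟨J, hJ, hX⟩, ⟨J, hJ, hZ⟩, hs⟩
  restrict := fun Y η ⟨J, hJ, h⟩ P c hη => by
    obtain ⟨η', h1, hd, h'⟩ := hJ.restrict Y η h P c hη
    exact ⟨η', h1, hd, J, hJ, h'⟩
  relabel := fun Y η ⟨J, hJ, h⟩ P f hη => by
    obtain ⟨η', h1, hd, h'⟩ := hJ.relabel Y η h P f hη
    exact ⟨η', h1, hd, J, hJ, h'⟩
  suffix := fun Y η ⟨J, hJ, h⟩ k hk => ⟨J, hJ, hJ.suffix Y η h k hk⟩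

/-- A path is just (equivalently, complete) if it is `Y`-just for some set `Y` of handshake
actions. -/
def Just (η : Path D) : Prop := ∃ Y : Set (Handshake A), η.JustFor Y

/-- A path is `c`-enabled if `c` belongs to every `Y` for which the path is `Y`-just. -/
def Enabled (c : Handshake A) (η : Path D) : Prop :=
  ∀ Y : Set (Handshake A), η.JustFor Y → c ∈ Y

end Path

end CCS

/-!
Fair schedulers cannot be expressed, because a component that perpetually offers the request `r 0`
while the rest of the system keeps serving `r 1` cannot exclude the rest from announcing `t 1`
next to its own `t 0`.

Transitions are annotated with the components that take part in them (`CCS.LocStep`), and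
transitions with disjoint sets of components commute (`CCS.LocStep.diamond`). Call an action
perpetually enabled in a run if from some point on it is enabled by components that never move
again. A run in which only handshakes are perpetually enabled presents a path that is `Y`-just for
`Y` the set of these handshakes (`CCS.Run.isJustFamily_presentedFor`). In particular it is just,
and if it is `c`-enabled then `c` is perpetually enabled. Only this half of the relation between
justness and perpetual enabledness is needed. Moreover, each run can be completed to a just one by
interleaving it with transitions that are no handshakes and are independent of what remains of the
given run (`CCS.Run.exists_just_interleaving`).

Suppose there were a fair scheduler. The completion of idling at a reachable state contains no
handshakes, so in it `r 1` becomes perpetually enabled. Hence `r 1` can be reached again and again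
without any other handshake; completing the resulting run gives a just run `η` with infinitely many
`r 1`, hence infinitely many `t 1`, but without `r 0` and so without `t 0`. In `η` the request `r 0`
is perpetually enabled. Make this request when it is no longer interfered with, let `η` go on as
before, and complete again. Now `t 0` has to occur. It does not belong to `η`, so it is one of the
additional transitions and is independent of the remainder of `η`; it can therefore be postponed
until just before the next `t 1`. Then `t 0` and `t 1` happen in immediate succession, leaving no
room for an `e` (`CCS.Run.IsScheduler.false`).
-/

namespace CCS

variable {A : Type u} {K : Type w} {O : Type x}

/-! ### Located transitions -/

theorem Handshake.bar_bar (c : Handshake A) : c.bar.bar = c := by cases c <;> rfl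

/-- The place of a transition in the tree of parallel compositions at the top of an expression:
`left`, `right` and `both` tell which sides of a parallel composition take part (restriction and
relabelling leave no trace), and `here` stands for a prefix, a choice or an agent identifier,
which is treated as a single sequential component. -/
inductive Loc : Type
  | here
  | left (l : Loc)
  | right (l : Loc)
  | both (l m : Loc)

namespace Loc

/-- Two places are independent if no sequential component takes part in both. -/
def Indep : Loc → Loc → Prop
  | here, _ => False
  | _, here => False
  | left l, left m => Indep l m
  | left _, right _ => True
  | left l, both m _ => Indep l m
  | right _, left _ => True
  | right l, right m => Indep l m
  | right l, both _ m => Indep l m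
  | both l _, left m => Indep l m
  | both _ l, right m => Indep l m
  | both l l', both m m' => Indep l m ∧ Indep l' m'

theorem Indep.irrefl (l : Loc) : ¬ Indep l l := by
  induction l <;> simp_all [Indep]

/-- An injective numbering of the places. -/
def code : Loc → ℕ
  | here => 0
  | left l => 3 * code l + 1
  | right l => 3 * code l + 2
  | both l m => 3 * Nat.pair (code l) (code m) + 3

theorem code_injective : Function.Injective code := by
  intro l
  induction l with
  | here => intro m h; cases m <;> simp [code] at h ⊢
  | left l ih =>
    intro m h
    cases m <;> simp only [code] at h
    case left m => rw [ih (by omega : code l = code m)]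
    all_goals omega
  | right l ih =>
    intro m h
    cases m <;> simp only [code] at h
    case right m => rw [ih (by omega : code l = code m)]
    all_goals omega
  | both l l' ih ih' =>
    intro m h
    cases m <;> simp only [code] at h
    case both m m' =>
      obtain ⟨h1, h2⟩ := Nat.pair_eq_pair.mp
        (by omega : Nat.pair (code l) (code l') = Nat.pair (code m) (code m'))
      rw [ih h1, ih' h2]
    all_goals omega

instance : Countable Loc := code_injective.countable

end Loc

/-- Transitions together with the place where they happen. -/
inductive LocStep (D : K → Expr.{u, w, x, v} A K O) :
    Expr.{u, w, x, v} A K O → Act A O → Loc → Expr.{u, w, x, v} A K O → Prop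
  | pre (α : Act A O) (P : Expr A K O) : LocStep D (.pre α P) α .here P
  | choice {I : Type v} {P : I → Expr A K O} {α : Act A O} {P' : Expr A K O} (j : I) :
      Step D (P j) α P' → LocStep D (.choice I P) α .here P'
  | parLeft {P P' Q : Expr A K O} {α : Act A O} {l : Loc} :
      LocStep D P α l P' → LocStep D (.par P Q) α (.left l) (.par P' Q)
  | parSync {P P' Q Q' : Expr A K O} {c : Handshake A} {l m : Loc} :
      LocStep D P (.hs c) l P' → LocStep D Q (.hs c.bar) m Q' →
        LocStep D (.par P Q) .tau (.both l m) (.par P' Q')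
  | parRight {P Q Q' : Expr A K O} {α : Act A O} {l : Loc} :
      LocStep D Q α l Q' → LocStep D (.par P Q) α (.right l) (.par P Q')
  | restrict {P P' : Expr A K O} {α : Act A O} {c : Handshake A} {l : Loc} :
      LocStep D P α l P' → α ≠ .hs c → α ≠ .hs c.bar →
        LocStep D (.restrict P c) α l (.restrict P' c)
  | relabel {P P' : Expr A K O} {α : Act A O} {f : Relabelling A} {l : Loc} :
      LocStep D P α l P' → LocStep D (.relabel P f) (f.onAct α) l (.relabel P' f)
  | ident {X : K} {α : Act A O} {P' : Expr A K O} :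
      Step D (D X) α P' → LocStep D (.ident X) α .here P'

variable {D : K → Expr.{u, w, x, v} A K O}

theorem LocStep.toStep {P P' : Expr A K O} {α : Act A O} {l : Loc} (h : LocStep D P α l P') :
    Step D P α P' := by
  induction h with
  | pre α P => exact .pre α P
  | choice j h => exact .choice j h
  | parLeft _ ih => exact .parLeft ih
  | parSync _ _ ih ih' => exact .parSync ih ih'
  | parRight _ ih => exact .parRight ih
  | restrict _ h h' ih => exact .restrict ih h h'
  | relabel _ ih => exact .relabel ih
  | ident h => exact .ident h

theorem Step.exists_locStep {P P' : Expr A K O} {α : Act A O} (h : Step D P α P') :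
    ∃ l, LocStep D P α l P' := by
  induction h with
  | pre α P => exact ⟨_, .pre α P⟩
  | choice j h => exact ⟨_, .choice j h⟩
  | parLeft _ ih => exact ih.imp' _ fun _ h => .parLeft h
  | parSync _ _ ih ih' =>
    obtain ⟨l, h⟩ := ih
    obtain ⟨m, h'⟩ := ih'
    exact ⟨_, .parSync h h'⟩
  | parRight _ ih => exact ih.imp' _ fun _ h => .parRight h
  | restrict _ h h' ih => exact ih.imp fun _ h1 => .restrict h1 h h'
  | relabel _ ih => exact ih.imp fun _ h => .relabel h
  | ident h => exact ⟨_, .ident h⟩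

/-- The diamond property: transitions at independent places commute. -/
theorem LocStep.diamond {P P₁ P₂ : Expr A K O} {α β : Act A O} {l m : Loc}
    (h : LocStep D P α l P₁) (h' : LocStep D P β m P₂) (hlm : l.Indep m) :
    ∃ P₃, LocStep D P₁ β m P₃ ∧ LocStep D P₂ α l P₃ := by
  induction h generalizing β m P₂ with
  | pre | choice | ident => simp [Loc.Indep] at hlm
  | parLeft h ih =>
    cases h' with
    | parLeft g =>
      obtain ⟨R, h1, h2⟩ := ih g (by simpa [Loc.Indep] using hlm)
      exact ⟨_, .parLeft h1, .parLeft h2⟩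
    | parRight g => exact ⟨_, .parRight g, .parLeft h⟩
    | parSync g g' =>
      obtain ⟨R, h1, h2⟩ := ih g (by simpa [Loc.Indep] using hlm)
      exact ⟨_, .parSync h1 g', .parLeft h2⟩
  | parRight h ih =>
    cases h' with
    | parLeft g => exact ⟨_, .parLeft g, .parRight h⟩
    | parRight g =>
      obtain ⟨R, h1, h2⟩ := ih g (by simpa [Loc.Indep] using hlm)
      exact ⟨_, .parRight h1, .parRight h2⟩
    | parSync g g' =>
      obtain ⟨R, h1, h2⟩ := ih g' (by simpa [Loc.Indep] using hlm)
      exact ⟨_, .parSync g h1, .parRight h2⟩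
  | parSync h₁ h₂ ih ih' =>
    cases h' with
    | parLeft g =>
      obtain ⟨R, h1, h2⟩ := ih g (by simpa [Loc.Indep] using hlm)
      exact ⟨_, .parLeft h1, .parSync h2 h₂⟩
    | parRight g =>
      obtain ⟨R, h1, h2⟩ := ih' g (by simpa [Loc.Indep] using hlm)
      exact ⟨_, .parRight h1, .parSync h₁ h2⟩
    | parSync g g' =>
      simp only [Loc.Indep] at hlm
      obtain ⟨R, h1, h2⟩ := ih g hlm.1
      obtain ⟨R', h1', h2'⟩ := ih' g' hlm.2
      exact ⟨_, .parSync h1 h1', .parSync h2 h2'⟩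
  | restrict h hc hc' ih =>
    cases h' with
    | restrict g gc gc' =>
      obtain ⟨R, h1, h2⟩ := ih g hlm
      exact ⟨_, .restrict h1 gc gc', .restrict h2 hc hc'⟩
  | relabel h ih =>
    cases h' with
    | relabel g =>
      obtain ⟨R, h1, h2⟩ := ih g hlm
      exact ⟨_, .relabel h1, .relabel h2⟩

/-! ### Runs -/

/-- One move of a run: a located transition, or idling. -/
inductive Move (D : K → Expr.{u, w, x, v} A K O) :
    Expr.{u, w, x, v} A K O → Option (Act A O × Loc) → Expr.{u, w, x, v} A K O → Prop
  | idle (P : Expr A K O) : Move D P none P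
  | step {P Q : Expr A K O} {α : Act A O} {l : Loc} :
      LocStep D P α l Q → Move D P (some (α, l)) Q

/-- The place `l` is independent of the move `o`. -/
def Free (l : Loc) (o : Option (Act A O × Loc)) : Prop :=
  ∀ β m, o = some (β, m) → l.Indep m

theorem LocStep.diamond_move {P P₁ P₂ : Expr A K O} {α : Act A O} {l : Loc}
    {o : Option (Act A O × Loc)} (h : LocStep D P α l P₁) (h' : Move D P o P₂) (hl : Free l o) :
    ∃ P₃, Move D P₁ o P₃ ∧ LocStep D P₂ α l P₃ := by
  cases h' with
  | idle => exact ⟨_, .idle _, h⟩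
  | step g =>
    obtain ⟨R, h1, h2⟩ := h.diamond g (hl _ _ rfl)
    exact ⟨R, .step h1, h2⟩

/-- A run is an infinite sequence of moves. As moves may be idle, runs present finite as well as
infinite paths; in contrast to paths they record where each transition happens. -/
structure Run (D : K → Expr.{u, w, x, v} A K O) : Type (max u w x (v + 1)) where
  state : ℕ → Expr.{u, w, x, v} A K O
  act : ℕ → Option (Act A O × Loc)
  move : ∀ n, Move D (state n) (act n) (state (n + 1))

namespace Run

/-- The run without its first `k` moves. -/
def drop (ρ : Run D) (k : ℕ) : Run D where
  state n := ρ.state (k + n)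
  act n := ρ.act (k + n)
  move n := ρ.move (k + n)

/-- The run that stays in `P` forever. -/
def idle (P : Expr A K O) : Run D where
  state _ := P
  act _ := none
  move _ := .idle P

/-- The run `ρ` preceded by one move from `P`. -/
def cons (P : Expr A K O) (o : Option (Act A O × Loc)) (ρ : Run D)
    (h : Move D P o (ρ.state 0)) : Run D where
  state n := n.casesOn P ρ.state
  act n := n.casesOn o ρ.act
  move n := n.casesOn h ρ.move

/-- The action `α` happens in the `n`-th move of `ρ`. -/
def HasAct (ρ : Run D) (α : Act A O) (n : ℕ) : Prop := ∃ l, ρ.act n = some (α, l)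

/-- From the `n`-th state of `ρ` on, a transition labelled `α` at place `l` is enabled and no
component taking part in it moves any more. -/
def PerpAt (ρ : Run D) (α : Act A O) (l : Loc) (n : ℕ) : Prop :=
  (∃ P, LocStep D (ρ.state n) α l P) ∧ ∀ k, n ≤ k → Free l (ρ.act k)

/-- The action `α` is perpetually enabled from some point of `ρ` on. -/
def Perp (ρ : Run D) (α : Act A O) : Prop := ∃ l n, ρ.PerpAt α l n

theorem PerpAt.mono {ρ : Run D} {α : Act A O} {l : Loc} {n k : ℕ} (h : ρ.PerpAt α l n)
    (hk : n ≤ k) : ρ.PerpAt α l k := by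
  refine ⟨?_, fun j hj => h.2 j (hk.trans hj)⟩
  induction k, hk using Nat.le_induction with
  | base => exact h.1
  | succ k hk ih =>
    obtain ⟨P, hP⟩ := ih
    obtain ⟨R, -, hR⟩ := hP.diamond_move (ρ.move k) (h.2 k hk)
    exact ⟨R, hR⟩

theorem perp_of_drop {ρ : Run D} {α : Act A O} {k : ℕ} (h : (ρ.drop k).Perp α) : ρ.Perp α := by
  obtain ⟨l, n, h1, h2⟩ := h
  refine ⟨l, k + n, h1, fun j hj => ?_⟩
  have := h2 (j - k) (by omega)
  simpa [drop, show k + (j - k) = j by omega] using this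

/-- A transition independent of all moves of a run can be performed first, and the same moves are
possible afterwards. -/
theorem exists_residual (ρ : Run D) {α : Act A O} {l : Loc} {P : Expr A K O}
    (h : LocStep D (ρ.state 0) α l P) (hl : ∀ n, Free l (ρ.act n)) :
    ∃ ρ' : Run D, ρ'.state 0 = P ∧ ρ'.act = ρ.act := by
  have key : ∀ n (Q : {Q // LocStep D (ρ.state n) α l Q}),
      ∃ R : {R // LocStep D (ρ.state (n + 1)) α l R}, Move D Q.1 (ρ.act n) R.1 := fun n Q => by
    obtain ⟨R, h1, h2⟩ := Q.2.diamond_move (ρ.move n) (hl n)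
    exact ⟨⟨R, h2⟩, h1⟩
  choose next hnext using key
  let s : (n : ℕ) → {Q // LocStep D (ρ.state n) α l Q} := fun n => Nat.rec ⟨P, h⟩ next n
  exact ⟨⟨fun n => (s n).1, ρ.act, fun n => hnext n (s n)⟩, rfl, rfl⟩

/-! ### The path presented by a run -/

/-- The number of transitions among the first `n` moves of `ρ`. -/
def count (ρ : Run D) (n : ℕ) : ℕ := Nat.count (fun k => (ρ.act k).isSome) n

@[simp] theorem count_zero (ρ : Run D) : ρ.count 0 = 0 := by simp [count]

theorem count_succ_of_none {ρ : Run D} {n : ℕ} (h : ρ.act n = none) :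
    ρ.count (n + 1) = ρ.count n := by simp [count, Nat.count_succ, h]

theorem count_succ_of_some {ρ : Run D} {n : ℕ} {a : Act A O × Loc} (h : ρ.act n = some a) :
    ρ.count (n + 1) = ρ.count n + 1 := by simp [count, Nat.count_succ, h]

theorem count_mono (ρ : Run D) : Monotone ρ.count := Nat.count_monotone _

theorem count_drop (ρ : Run D) (k n : ℕ) : (ρ.drop k).count n = ρ.count (k + n) - ρ.count k := by
  unfold count
  rw [Nat.count_add, Nat.add_sub_cancel_left]
  rfl

theorem act_eq_none_of_count_eq {ρ : Run D} {n m k : ℕ} (h : ρ.count n = ρ.count m)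
    (hn : n ≤ k) (hm : k < m) : ρ.act k = none := by
  rcases ho : ρ.act k with _ | a
  · rfl
  · have h1 := count_succ_of_some ho
    have h2 := ρ.count_mono hn
    have h3 := ρ.count_mono (Nat.succ_le_of_lt hm)
    simp only [Nat.succ_eq_add_one] at h3
    omega

/-- A quantity that does not change in idle moves depends on the number of transitions only. -/
theorem eq_of_count_eq {ρ : Run D} {β : Type*} {g : ℕ → β}
    (hg : ∀ n, ρ.act n = none → g (n + 1) = g n) {n m : ℕ} (h : ρ.count n = ρ.count m) :
    g n = g m := by
  wlog hnm : n ≤ m generalizing n m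
  · exact (this h.symm (by omega)).symm
  suffices ∀ k, n ≤ k → k ≤ m → g k = g n from (this m hnm le_rfl).symm
  intro k hk
  induction k, hk using Nat.le_induction with
  | base => simp
  | succ k hk ih =>
    intro hkm
    rw [hg k (act_eq_none_of_count_eq h hk (by omega)), ih (by omega)]

theorem exists_comp_count {ρ : Run D} {β : Type*} [Nonempty β] {g : ℕ → β}
    (hg : ∀ n, ρ.act n = none → g (n + 1) = g n) : ∃ a : ℕ → β, ∀ n, a (ρ.count n) = g n := by
  have h : Function.FactorsThrough g ρ.count := fun n m h => eq_of_count_eq hg h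
  exact ⟨_, h.extend_apply fun _ => Classical.arbitrary β⟩

/-- The run `ρ` presents the path that arises from it by deleting the idle moves and forgetting
the places. -/
structure Presents (ρ : Run D) (η : Path D) : Prop where
  state : ∀ n, η.state (ρ.count n) = ρ.state n
  label : ∀ n α l, ρ.act n = some (α, l) → η.label (ρ.count n) = α
  len : η.len = ⨆ n, (ρ.count n : ℕ∞)

theorem exists_count_eq_of_lt {ρ : Run D} {k : ℕ} (h : (k : ℕ∞) < ⨆ n, (ρ.count n : ℕ∞)) :
    ∃ n, ρ.count n = k ∧ ∃ α l, ρ.act n = some (α, l) := by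
  obtain ⟨m, hm⟩ := lt_iSup_iff.mp h
  have hex : ∃ m, k < ρ.count m := ⟨m, by exact_mod_cast hm⟩
  have h1 := Nat.find_spec hex
  obtain ⟨n, hn⟩ : ∃ n, Nat.find hex = n + 1 :=
    Nat.exists_eq_succ_of_ne_zero fun h0 => by simp [h0] at h1
  have h2 := Nat.find_min hex (m := n) (by omega)
  rw [hn] at h1
  rcases ho : ρ.act n with _ | ⟨α, l⟩
  · rw [count_succ_of_none ho] at h1
    exact absurd h1 h2
  · rw [count_succ_of_some ho] at h1
    exact ⟨n, by omega, α, l, ho⟩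

theorem exists_count_eq_of_le {ρ : Run D} {k : ℕ} (h : (k : ℕ∞) ≤ ⨆ n, (ρ.count n : ℕ∞)) :
    ∃ n, ρ.count n = k := by
  cases k with
  | zero => exact ⟨0, by simp⟩
  | succ k =>
    obtain ⟨n, hn, α, l, ho⟩ := exists_count_eq_of_lt
      (lt_of_lt_of_le (by exact_mod_cast Nat.lt_succ_self k) h)
    exact ⟨n + 1, by rw [count_succ_of_some ho, hn]⟩

theorem count_le_iSup (ρ : Run D) (n : ℕ) : (ρ.count n : ℕ∞) ≤ ⨆ n, (ρ.count n : ℕ∞) :=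
  le_iSup (fun n => (ρ.count n : ℕ∞)) n

theorem count_lt_iSup {ρ : Run D} {n : ℕ} {a : Act A O × Loc} (h : ρ.act n = some a) :
    (ρ.count n : ℕ∞) < ⨆ n, (ρ.count n : ℕ∞) :=
  lt_of_lt_of_le (by rw [count_succ_of_some h]; exact_mod_cast Nat.lt_succ_self _)
    (ρ.count_le_iSup (n + 1))

theorem state_succ_of_none {ρ : Run D} {n : ℕ} (h : ρ.act n = none) :
    ρ.state (n + 1) = ρ.state n := by
  have := ρ.move n
  rw [h] at this
  generalize ρ.state (n + 1) = R at *
  cases this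
  rfl

theorem locStep_of_some {ρ : Run D} {n : ℕ} {α : Act A O} {l : Loc}
    (h : ρ.act n = some (α, l)) : LocStep D (ρ.state n) α l (ρ.state (n + 1)) := by
  have := ρ.move n
  rw [h] at this
  generalize ρ.state (n + 1) = R at *
  cases this
  assumption

theorem exists_presents (ρ : Run D) : ∃ η : Path D, ρ.Presents η := by
  have : Nonempty (Expr.{u, w, x, v} A K O) := ⟨ρ.state 0⟩
  obtain ⟨s, hs⟩ := exists_comp_count (g := ρ.state) fun _ h => state_succ_of_none h
  have hlab : ∀ k : ℕ, ∃ α : Act A O, ∀ n β l, ρ.count n = k → ρ.act n = some (β, l) → β = α := by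
    intro k
    by_cases hk : ∃ n, ρ.count n = k ∧ ∃ α l, ρ.act n = some (α, l)
    · obtain ⟨n, hn, α, l, ho⟩ := hk
      refine ⟨α, fun m β l' hm ho' => ?_⟩
      have : n = m := by
        refine Nat.count_injective (p := fun k => (ρ.act k).isSome) ?_ ?_ (hn.trans hm.symm)
        · simp [ho]
        · simp [ho']
      subst this
      rw [ho] at ho'
      cases ho'
      rfl
    · exact ⟨.tau, fun n β l hn ho => (hk ⟨n, hn, β, l, ho⟩).elim⟩
  choose lab hlab using hlab
  refine ⟨⟨⨆ n, (ρ.count n : ℕ∞), s, lab, fun k hk => ?_⟩, hs, fun n α l h => ?_, rfl⟩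
  · obtain ⟨n, rfl, α, l, ho⟩ := exists_count_eq_of_lt hk
    rw [hs, ← hlab _ n α l rfl ho, ← count_succ_of_some ho, hs]
    exact (locStep_of_some ho).toStep
  · exact (hlab _ n α l rfl h).symm

namespace Presents

variable {ρ : Run D} {η : Path D}

theorem state_zero (h : ρ.Presents η) : η.state 0 = ρ.state 0 := by simpa using h.state 0

theorem exists_of_lt (h : ρ.Presents η) {k : ℕ} (hk : (k : ℕ∞) < η.len) :
    ∃ n, ρ.count n = k ∧ ∃ α l, ρ.act n = some (α, l) :=
  exists_count_eq_of_lt (h.len ▸ hk)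

theorem exists_of_le (h : ρ.Presents η) {k : ℕ} (hk : (k : ℕ∞) ≤ η.len) : ∃ n, ρ.count n = k :=
  exists_count_eq_of_le (h.len ▸ hk)

theorem occursAt (h : ρ.Presents η) {α : Act A O} {n : ℕ} (hα : ρ.HasAct α n) :
    η.OccursAt α (ρ.count n) := by
  obtain ⟨l, hl⟩ := hα
  exact ⟨h.len ▸ count_lt_iSup hl, h.label n α l hl⟩

theorem exists_hasAct (h : ρ.Presents η) {α : Act A O} {k : ℕ} (hα : η.OccursAt α k) :
    ∃ n, ρ.count n = k ∧ ρ.HasAct α n := by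
  obtain ⟨n, rfl, β, l, ho⟩ := h.exists_of_lt hα.1
  have := h.label n β l ho
  rw [hα.2] at this
  exact ⟨n, rfl, l, this ▸ ho⟩

theorem suffix (h : ρ.Presents η) (k : ℕ) : (ρ.drop k).Presents (η.suffix (ρ.count k)) where
  state n := by
    have := ρ.count_mono (Nat.le_add_right k n)
    simp only [Path.suffix, count_drop]
    rw [show ρ.count k + (ρ.count (k + n) - ρ.count k) = ρ.count (k + n) by omega, h.state]
    rfl
  label n α l hl := by
    have := ρ.count_mono (Nat.le_add_right k n)
    simp only [Path.suffix, count_drop]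
    rw [show ρ.count k + (ρ.count (k + n) - ρ.count k) = ρ.count (k + n) by omega]
    exact h.label _ α l hl
  len := by
    simp only [Path.suffix, h.len, count_drop]
    refine le_antisymm ?_ (iSup_le fun n => ?_)
    · rw [tsub_le_iff_right]
      refine iSup_le fun n => ?_
      have h1 := ρ.count_mono (Nat.le_add_left n k)
      refine le_trans ?_ (add_le_add_left
        (le_iSup (fun n => ((ρ.count (k + n) - ρ.count k : ℕ) : ℕ∞)) n) _)
      exact_mod_cast (by omega : ρ.count n ≤ ρ.count (k + n) - ρ.count k + ρ.count k)
    · rw [ENat.natCast_sub]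
      exact tsub_le_tsub_right (ρ.count_le_iSup (k + n)) _

end Presents

/-! ### Just runs present just paths -/

/-- How a move of a parallel composition splits into moves of its two sides. -/
inductive SplitsPar : Option (Act A O × Loc) → Option (Act A O × Loc) →
    Option (Act A O × Loc) → Prop
  | idle : SplitsPar none none none
  | left (α : Act A O) (l : Loc) : SplitsPar (some (α, .left l)) (some (α, l)) none
  | right (α : Act A O) (l : Loc) : SplitsPar (some (α, .right l)) none (some (α, l))
  | both (c : Handshake A) (l m : Loc) :
      SplitsPar (some (.tau, .both l m)) (some (.hs c, l)) (some (.hs c.bar, m))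

theorem exists_splitsPar {P Q R : Expr A K O} {o : Option (Act A O × Loc)}
    (h : Move D (.par P Q) o R) : ∃ P' Q' o₁ o₂, R = .par P' Q' ∧ SplitsPar o o₁ o₂ ∧
      Move D P o₁ P' ∧ Move D Q o₂ Q' := by
  cases h with
  | idle => exact ⟨_, _, _, _, rfl, .idle, .idle _, .idle _⟩
  | step h =>
    cases h with
    | parLeft h => exact ⟨_, _, _, _, rfl, .left _ _, .step h, .idle _⟩
    | parRight h => exact ⟨_, _, _, _, rfl, .right _ _, .idle _, .step h⟩
    | parSync h h' => exact ⟨_, _, _, _, rfl, .both _ _ _, .step h, .step h'⟩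

theorem exists_par_runs {ρ : Run D} {P Q : Expr A K O} (h : ρ.state 0 = .par P Q) :
    ∃ ρ₁ ρ₂ : Run D, ρ₁.state 0 = P ∧ ρ₂.state 0 = Q ∧
      (∀ n, ρ.state n = .par (ρ₁.state n) (ρ₂.state n)) ∧
      ∀ n, SplitsPar (ρ.act n) (ρ₁.act n) (ρ₂.act n) := by
  have key : ∀ n (p : {p : Expr A K O × Expr A K O // ρ.state n = .par p.1 p.2}),
      ∃ (q : {q : Expr A K O × Expr A K O // ρ.state (n + 1) = .par q.1 q.2})
        (o₁ o₂ : Option (Act A O × Loc)), SplitsPar (ρ.act n) o₁ o₂ ∧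
        Move D p.1.1 o₁ q.1.1 ∧ Move D p.1.2 o₂ q.1.2 := fun n p => by
    have hm := ρ.move n
    rw [p.2] at hm
    obtain ⟨P', Q', o₁, o₂, hR, h1, h2, h3⟩ := exists_splitsPar hm
    exact ⟨⟨(P', Q'), hR⟩, o₁, o₂, h1, h2, h3⟩
  choose next a b hs h1 h2 using key
  let s : (n : ℕ) → {p : Expr A K O × Expr A K O // ρ.state n = .par p.1 p.2} :=
    fun n => Nat.rec ⟨(P, Q), h⟩ next n
  exact ⟨⟨fun n => (s n).1.1, fun n => a n (s n), fun n => h1 n (s n)⟩,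
    ⟨fun n => (s n).1.2, fun n => b n (s n), fun n => h2 n (s n)⟩, rfl, rfl,
    fun n => (s n).2, fun n => hs n (s n)⟩

theorem exists_restrict_run {ρ : Run D} {P : Expr A K O} {c : Handshake A}
    (h : ρ.state 0 = .restrict P c) :
    ∃ ρ' : Run D, ρ'.state 0 = P ∧ (∀ n, ρ.state n = .restrict (ρ'.state n) c) ∧
      ρ'.act = ρ.act := by
  have key : ∀ n (p : {p : Expr A K O // ρ.state n = .restrict p c}),
      ∃ q : {q : Expr A K O // ρ.state (n + 1) = .restrict q c}, Move D p.1 (ρ.act n) q.1 :=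
    fun n p => by
      have hm := ρ.move n
      rw [p.2] at hm
      generalize ρ.state (n + 1) = R at *
      generalize ρ.act n = o at *
      cases hm with
      | idle => exact ⟨⟨_, rfl⟩, .idle _⟩
      | step hm => cases hm with
        | restrict hm => exact ⟨⟨_, rfl⟩, .step hm⟩
  choose next hnext using key
  let s : (n : ℕ) → {p : Expr A K O // ρ.state n = .restrict p c} :=
    fun n => Nat.rec ⟨P, h⟩ next n
  exact ⟨⟨fun n => (s n).1, ρ.act, fun n => hnext n (s n)⟩, rfl, fun n => (s n).2, rfl⟩

theorem exists_relabel_run {ρ : Run D} {P : Expr A K O} {f : Relabelling A}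
    (h : ρ.state 0 = .relabel P f) :
    ∃ ρ' : Run D, ρ'.state 0 = P ∧ (∀ n, ρ.state n = .relabel (ρ'.state n) f) ∧
      ∀ n, ρ.act n = (ρ'.act n).map (Prod.map f.onAct id) := by
  have key : ∀ n (p : {p : Expr A K O // ρ.state n = .relabel p f}),
      ∃ (q : {q : Expr A K O // ρ.state (n + 1) = .relabel q f}) (o : Option (Act A O × Loc)),
        ρ.act n = o.map (Prod.map f.onAct id) ∧ Move D p.1 o q.1 :=
    fun n p => by
      have hm := ρ.move n
      rw [p.2] at hm
      generalize ρ.state (n + 1) = R at *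
      generalize ρ.act n = o at *
      cases hm with
      | idle => exact ⟨⟨_, rfl⟩, none, rfl, .idle _⟩
      | step hm => cases hm with
        | relabel hm => exact ⟨⟨_, rfl⟩, some (_, _), rfl, .step hm⟩
  choose next a ha hnext using key
  let s : (n : ℕ) → {p : Expr A K O // ρ.state n = .relabel p f} :=
    fun n => Nat.rec ⟨P, h⟩ next n
  exact ⟨⟨fun n => (s n).1, fun n => a n (s n), fun n => hnext n (s n)⟩, rfl,
    fun n => (s n).2, fun n => ha n (s n)⟩

/-- A run is just if only handshake actions are perpetually enabled in it. -/
def IsJust (ρ : Run D) : Prop := ∀ α, ρ.Perp α → ∃ c, α = .hs c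

/-- The path is presented by a run in which the perpetually enabled actions are handshakes in
`Y`. -/
def PresentedFor (Y : Set (Handshake A)) (η : Path D) : Prop :=
  ∃ ρ : Run D, ρ.Presents η ∧ ∀ α, ρ.Perp α → ∃ c ∈ Y, α = .hs c

theorem presents_par_decomposes {ρ ρ₁ ρ₂ : Run D} {η η₁ η₂ : Path D} (hρ : ρ.Presents η)
    (h₁ : ρ₁.Presents η₁) (h₂ : ρ₂.Presents η₂)
    (hs : ∀ n, ρ.state n = .par (ρ₁.state n) (ρ₂.state n))
    (ha : ∀ n, SplitsPar (ρ.act n) (ρ₁.act n) (ρ₂.act n)) : η.DecomposesPar η₁ η₂ := by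
  have hidle : ∀ n, ρ.act n = none → ρ₁.act n = none ∧ ρ₂.act n = none := fun n h => by
    have := ha n
    rw [h] at this
    generalize ρ₁.act n = o₁ at *
    generalize ρ₂.act n = o₂ at *
    cases this
    exact ⟨rfl, rfl⟩
  obtain ⟨a, haa⟩ := exists_comp_count (g := ρ₁.count)
    fun n h => count_succ_of_none (hidle n h).1
  obtain ⟨b, hbb⟩ := exists_comp_count (g := ρ₂.count)
    fun n h => count_succ_of_none (hidle n h).2
  refine ⟨a, b, by simpa using haa 0, by simpa using hbb 0, fun k hk => ?_, fun k hk => ?_,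
    ?_, ?_⟩
  · obtain ⟨n, rfl⟩ := hρ.exists_of_le hk
    rw [haa, hbb, hρ.state, h₁.state, h₂.state, hs]
  · obtain ⟨n, rfl, α, l, ho⟩ := hρ.exists_of_lt hk
    have hsplit := ha n
    rw [← count_succ_of_some ho, haa, haa, hbb, hbb, hρ.label n α l ho]
    rw [ho] at hsplit
    rcases ho₁ : ρ₁.act n with _ | ⟨α₁, l₁⟩ <;> rcases ho₂ : ρ₂.act n with _ | ⟨α₂, l₂⟩ <;>
      rw [ho₁, ho₂] at hsplit
    · cases hsplit
    · rw [count_succ_of_none ho₁, count_succ_of_some ho₂, h₂.label n _ _ ho₂]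
      cases hsplit
      exact .inr (.inl ⟨rfl, rfl, rfl⟩)
    · rw [count_succ_of_some ho₁, count_succ_of_none ho₂, h₁.label n _ _ ho₁]
      cases hsplit
      exact .inl ⟨rfl, rfl, rfl⟩
    · rw [count_succ_of_some ho₁, count_succ_of_some ho₂, h₁.label n _ _ ho₁,
        h₂.label n _ _ ho₂]
      cases hsplit
      exact .inr (.inr ⟨rfl, rfl, rfl, _, rfl, rfl⟩)
  · rw [h₁.len]
    refine le_antisymm (iSup_le fun n => ?_) (iSup₂_le fun k hk => ?_)
    · rw [← haa n]
      exact le_iSup₂_of_le (ρ.count n) (hρ.len ▸ ρ.count_le_iSup n) le_rfl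
    · obtain ⟨n, rfl⟩ := hρ.exists_of_le hk
      exact haa n ▸ ρ₁.count_le_iSup n
  · rw [h₂.len]
    refine le_antisymm (iSup_le fun n => ?_) (iSup₂_le fun k hk => ?_)
    · rw [← hbb n]
      exact le_iSup₂_of_le (ρ.count n) (hρ.len ▸ ρ.count_le_iSup n) le_rfl
    · obtain ⟨n, rfl⟩ := hρ.exists_of_le hk
      exact hbb n ▸ ρ₂.count_le_iSup n

theorem perpAt_par_left {ρ ρ₁ ρ₂ : Run D}
    (hs : ∀ n, ρ.state n = .par (ρ₁.state n) (ρ₂.state n))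
    (ha : ∀ n, SplitsPar (ρ.act n) (ρ₁.act n) (ρ₂.act n))
    {α : Act A O} {l : Loc} {n : ℕ}
    (h : ρ₁.PerpAt α l n) :
    ρ.PerpAt α (.left l) n := by
  obtain ⟨⟨P, hP⟩, hl⟩ := h
  refine ⟨⟨_, by rw [hs n]; exact .parLeft hP⟩, fun k hk β m ho => ?_⟩
  have h1 := hl k hk
  have h2 := ha k
  rw [ho] at h2
  generalize ρ₁.act k = o₁ at *
  generalize ρ₂.act k = o₂ at *
  cases h2 <;> simp_all [Free, Loc.Indep]

theorem perpAt_par_right {ρ ρ₁ ρ₂ : Run D}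
    (hs : ∀ n, ρ.state n = .par (ρ₁.state n) (ρ₂.state n))
    (ha : ∀ n, SplitsPar (ρ.act n) (ρ₁.act n) (ρ₂.act n))
    {α : Act A O} {l : Loc} {n : ℕ}
    (h : ρ₂.PerpAt α l n) :
    ρ.PerpAt α (.right l) n := by
  obtain ⟨⟨P, hP⟩, hl⟩ := h
  refine ⟨⟨_, by rw [hs n]; exact .parRight hP⟩, fun k hk β m ho => ?_⟩
  have h1 := hl k hk
  have h2 := ha k
  rw [ho] at h2
  generalize ρ₁.act k = o₁ at *
  generalize ρ₂.act k = o₂ at *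
  cases h2 <;> simp_all [Free, Loc.Indep]

theorem perpAt_par_sync {ρ ρ₁ ρ₂ : Run D}
    (hs : ∀ n, ρ.state n = .par (ρ₁.state n) (ρ₂.state n))
    (ha : ∀ n, SplitsPar (ρ.act n) (ρ₁.act n) (ρ₂.act n))
    {c : Handshake A} {l m : Loc} {n : ℕ}
    (h : ρ₁.PerpAt (.hs c) l n)
    (h' : ρ₂.PerpAt (.hs c.bar) m n) : ρ.PerpAt .tau (.both l m) n := by
  obtain ⟨⟨P, hP⟩, hl⟩ := h
  obtain ⟨⟨Q, hQ⟩, hm⟩ := h'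
  refine ⟨⟨_, by rw [hs n]; exact .parSync hP hQ⟩, fun k hk β m' ho => ?_⟩
  have h1 := hl k hk
  have h1' := hm k hk
  have h2 := ha k
  rw [ho] at h2
  generalize ρ₁.act k = o₁ at *
  generalize ρ₂.act k = o₂ at *
  cases h2 <;> simp_all [Free, Loc.Indep]

/-- The key case is that of a parallel composition: if complementary
handshakes were perpetually enabled on its two sides, then so would be their synchronisation,
which is not a handshake. -/
theorem isJustFamily_presentedFor : IsJustFamily D (PresentedFor (D := D)) where
  finite := fun Y η ⟨ρ, hρ, hY⟩ k hk α Q hQ => by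
    obtain ⟨n, rfl⟩ := hρ.exists_of_le hk.ge
    rw [hρ.state] at hQ
    obtain ⟨l, hl⟩ := hQ.exists_locStep
    refine hY α ⟨l, n, ⟨Q, hl⟩, fun j hj β m ho => ?_⟩
    have h1 := count_lt_iSup ho
    rw [← hρ.len, hk] at h1
    have h2 := ρ.count_mono hj
    have h3 : ρ.count j < ρ.count n := by exact_mod_cast h1
    omega
  par := fun Y η ⟨ρ, hρ, hY⟩ P Q hη => by
    obtain ⟨ρ₁, ρ₂, h1, h2, hs, ha⟩ := exists_par_runs (hρ.state_zero.symm.trans hη)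
    obtain ⟨η₁, hη₁⟩ := ρ₁.exists_presents
    obtain ⟨η₂, hη₂⟩ := ρ₂.exists_presents
    have hleft : ∀ α, ρ₁.Perp α → ∃ c ∈ Y, α = .hs c := fun α ⟨l, n, h⟩ =>
      hY α ⟨_, n, perpAt_par_left hs ha h⟩
    have hright : ∀ α, ρ₂.Perp α → ∃ c ∈ Y, α = .hs c := fun α ⟨l, n, h⟩ =>
      hY α ⟨_, n, perpAt_par_right hs ha h⟩
    refine ⟨{c | ρ₁.Perp (.hs c)}, {c | ρ₂.Perp (.hs c)}, η₁, η₂, hη₁.state_zero.trans h1,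
      hη₂.state_zero.trans h2, presents_par_decomposes hρ hη₁ hη₂ hs ha,
      ⟨ρ₁, hη₁, fun α h => ?_⟩, ⟨ρ₂, hη₂, fun α h => ?_⟩, ?_, ?_⟩
    · obtain ⟨c, -, rfl⟩ := hleft α h
      exact ⟨c, h, rfl⟩
    · obtain ⟨c, -, rfl⟩ := hright α h
      exact ⟨c, h, rfl⟩
    · rintro c (h | h)
      · obtain ⟨d, hd, hcd⟩ := hleft _ h
        cases hcd
        exact hd
      · obtain ⟨d, hd, hcd⟩ := hright _ h
        cases hcd
        exact hd
    · rw [Set.eq_empty_iff_forall_notMem]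
      rintro c ⟨⟨l, n, hc⟩, d, ⟨m, k, hd⟩, rfl⟩
      have hd' : ρ₂.PerpAt (.hs d.bar.bar) m k := by rwa [Handshake.bar_bar]
      obtain ⟨_, _, h⟩ := hY .tau ⟨_, _, perpAt_par_sync hs ha
        (hc.mono (le_max_left n k)) (hd'.mono (le_max_right n k))⟩
      cases h
  restrict := fun Y η ⟨ρ, hρ, hY⟩ P c hη => by
    obtain ⟨ρ', h1, hs, ha⟩ := exists_restrict_run (hρ.state_zero.symm.trans hη)
    obtain ⟨η', hη'⟩ := ρ'.exists_presents
    have hc : ρ'.count = ρ.count := by funext n; simp [count, ha]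
    refine ⟨η', hη'.state_zero.trans h1, ⟨?_, fun k hk => ?_, fun k hk => ?_⟩, ρ', hη',
      fun α h => ?_⟩
    · rw [hη'.len, hρ.len, hc]
    · obtain ⟨n, rfl⟩ := hρ.exists_of_le hk
      rw [hρ.state, hs, ← hc, hη'.state]
    · obtain ⟨n, rfl, α, l, ho⟩ := hρ.exists_of_lt hk
      rw [hρ.label n α l ho, ← hc, hη'.label n α l (ha ▸ ho)]
    · by_cases h2 : α = .hs c
      · exact ⟨c, by simp, h2⟩
      by_cases h3 : α = .hs c.bar
      · exact ⟨c.bar, by simp, h3⟩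
      obtain ⟨l, n, ⟨Q, hQ⟩, hl⟩ := h
      obtain ⟨d, hd, h⟩ := hY α ⟨l, n, ⟨_, by rw [hs n]; exact .restrict hQ h2 h3⟩,
        ha ▸ hl⟩
      exact ⟨d, .inl hd, h⟩
  relabel := fun Y η ⟨ρ, hρ, hY⟩ P f hη => by
    obtain ⟨ρ', h1, hs, ha⟩ := exists_relabel_run (hρ.state_zero.symm.trans hη)
    obtain ⟨η', hη'⟩ := ρ'.exists_presents
    have hc : ρ'.count = ρ.count := by funext n; simp [count, ha]
    refine ⟨η', hη'.state_zero.trans h1, ⟨?_, fun k hk => ?_, fun k hk => ?_⟩, ρ', hη',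
      fun α h => ?_⟩
    · rw [hη'.len, hρ.len, hc]
    · obtain ⟨n, rfl⟩ := hρ.exists_of_le hk
      rw [hρ.state, hs, ← hc, hη'.state]
    · obtain ⟨n, rfl, α, l, ho⟩ := hη'.exists_of_lt
        (hk.trans_eq (by rw [hη'.len, hρ.len, hc]))
      rw [hη'.label n α l ho, hc, hρ.label n (f.onAct α) l (by rw [ha, ho]; rfl)]
    · obtain ⟨l, n, ⟨Q, hQ⟩, hl⟩ := h
      obtain ⟨d, hd, h⟩ := hY (f.onAct α) ⟨l, n, ⟨_, by rw [hs n]; exact .relabel hQ⟩,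
        fun k hk β m ho => by
          rw [ha, Option.map_eq_some_iff] at ho
          obtain ⟨⟨γ, m'⟩, ho, h⟩ := ho
          cases h
          exact hl k hk _ _ ho⟩
      cases α with
      | hs c =>
        cases h
        exact ⟨c, hd, rfl⟩
      | out o => cases h
      | tau => cases h
  suffix := fun Y η ⟨ρ, hρ, hY⟩ k hk => by
    obtain ⟨n, rfl⟩ := hρ.exists_of_le hk
    exact ⟨ρ.drop n, hρ.suffix n, fun α h => hY α (perp_of_drop h)⟩

theorem Presents.justFor {ρ : Run D} {η : Path D} (h : ρ.Presents η) (hρ : ρ.IsJust) :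
    η.JustFor {c | ρ.Perp (.hs c)} := by
  refine ⟨_, isJustFamily_presentedFor, ρ, h, fun α hα => ?_⟩
  obtain ⟨c, rfl⟩ := hρ α hα
  exact ⟨c, hα, rfl⟩

/-! ### Completing a run to a just run -/

/-- There is a sequence in which every place, and also `none`, appears infinitely often. -/
theorem exists_schedule : ∃ f : ℕ → Option Loc, ∀ o n, ∃ m, n ≤ m ∧ f m = o := by
  obtain ⟨g, hg⟩ := exists_surjective_nat (Option Loc)
  refine ⟨fun m => g m.unpair.1, fun o n => ?_⟩
  obtain ⟨a, rfl⟩ := hg o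
  exact ⟨Nat.pair a n, Nat.right_le_pair a n, by simp⟩

/-- Every run `ρ` can be completed to a just run `ζ` by interleaving its moves with further
transitions that are not handshakes and are independent of the remaining moves of `ρ`: whenever
`ζ` makes such an extra transition, the remaining moves of `ρ` are also possible without it. -/
theorem exists_just_interleaving (ρ : Run D) : ∃ ζ : Run D, ζ.state 0 = ρ.state 0 ∧ ζ.IsJust ∧
    (∀ k, ∃ m, ζ.act m = ρ.act k) ∧
    (∀ n, ∃ s, ∀ k, ∃ m, n ≤ m ∧ ζ.act m = ρ.act (s + k)) ∧
    ∀ n, (∃ k, ζ.act n = ρ.act k) ∨ ∃ α l, ζ.act n = some (α, l) ∧ (∀ c, α ≠ .hs c) ∧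
      ∃ (R : Run D) (s : ℕ), R.state 0 = ζ.state n ∧ (∀ k, R.act k = ρ.act (s + k)) ∧
        ∀ k, Free l (R.act k) := by
  classical
  obtain ⟨f, hf⟩ := exists_schedule
  -- A stage of the construction is the run `R` of moves of `ρ` still to be made. Either its
  -- first move is made, or an extra transition at the place that the schedule proposes.
  let Plan (R : Run D) (o : Option (Act A O × Loc)) (R' : Run D) : Prop :=
    o = R.act 0 ∧ ∀ k, R'.act k = R.act (1 + k)
  let Extra (R : Run D) (α : Act A O) (l : Loc) : Prop :=
    (∀ c, α ≠ .hs c) ∧ (∃ P, LocStep D (R.state 0) α l P) ∧ ∀ k, Free l (R.act k)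
  have key : ∀ (n : ℕ) (R : Run D), ∃ (o : Option (Act A O × Loc)) (R' : Run D),
      Move D (R.state 0) o (R'.state 0) ∧
      (Plan R o R' ∨ f n ≠ none ∧ ∃ α l, Extra R α l ∧ o = some (α, l) ∧ R'.act = R.act) ∧
      (∀ α l, f n = some l → Extra R α l → ∃ β, o = some (β, l)) := by
    intro n R
    by_cases h : ∃ α l, f n = some l ∧ Extra R α l
    · obtain ⟨α, l, hn, hα⟩ := h
      obtain ⟨-, ⟨P, hP⟩, hl⟩ := id hα
      obtain ⟨R', h1, h2⟩ := R.exists_residual hP hl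
      refine ⟨some (α, l), R', h1 ▸ .step hP, .inr ⟨by simp [hn], α, l, hα, rfl, h2⟩,
        fun β m hm _ => ⟨α, ?_⟩⟩
      rw [hn] at hm
      cases hm
      rfl
    · exact ⟨R.act 0, R.drop 1, R.move 0, .inl ⟨rfl, fun k => rfl⟩,
        fun α l hn hα => (h ⟨α, l, hn, hα⟩).elim⟩
  choose o next hmove hcase hextra using key
  let R : ℕ → Run D := fun n => Nat.rec ρ next n
  have hR : ∀ n, R (n + 1) = next n (R n) := fun n => rfl
  let ζ : Run D := ⟨fun n => (R n).state 0, fun n => o n (R n), fun n => hmove n (R n)⟩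
  have htail : ∀ n, ∃ s, ∀ k, (R n).act k = ρ.act (s + k) := by
    intro n
    induction n with
    | zero => exact ⟨0, fun k => by rw [zero_add]; rfl⟩
    | succ n ih =>
      obtain ⟨s, hs⟩ := ih
      rcases hcase n (R n) with h | ⟨-, α, l, -, -, h⟩
      · exact ⟨s + 1, fun k => by rw [hR, h.2, hs, add_assoc]⟩
      · exact ⟨s, fun k => by rw [hR, h, hs]⟩
  -- The schedule proposes `none` again and again, so every planned move is made eventually.
  have hfirst : ∀ d n, f (n + d) = none →
      ∃ m, n ≤ m ∧ ζ.act m = (R n).act 0 ∧ ∀ k, (R (m + 1)).act k = (R n).act (1 + k) := by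
    intro d
    induction d with
    | zero =>
      intro n hn
      rcases hcase n (R n) with h | ⟨h, -⟩
      · exact ⟨n, le_rfl, h.1, h.2⟩
      · exact (h hn).elim
    | succ d ih =>
      intro n hn
      rcases hcase n (R n) with h | ⟨-, α, l, -, -, h⟩
      · exact ⟨n, le_rfl, h.1, h.2⟩
      · obtain ⟨m, hm, h1, h2⟩ := ih (n + 1) (by rw [← hn]; congr 1; omega)
        rw [hR, h] at h1 h2
        exact ⟨m, by omega, h1, h2⟩
  have hplan : ∀ k n, ∃ m, n ≤ m ∧ ζ.act m = (R n).act k := by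
    intro k
    induction k with
    | zero =>
      intro n
      obtain ⟨m, hm, hfm⟩ := hf none n
      obtain ⟨j, hj, h, -⟩ := hfirst (m - n) n (by rwa [Nat.add_sub_cancel' hm])
      exact ⟨j, hj, h⟩
    | succ k ih =>
      intro n
      obtain ⟨m, hm, hfm⟩ := hf none n
      obtain ⟨j, hj, -, h⟩ := hfirst (m - n) n (by rwa [Nat.add_sub_cancel' hm])
      obtain ⟨i, hi, h'⟩ := ih (j + 1)
      exact ⟨i, by omega, by rw [h', h, add_comm]⟩
  refine ⟨ζ, rfl, ?_, fun k => ?_, fun n => ?_, fun n => ?_⟩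
  · rintro α ⟨l, n, hα⟩
    by_contra! hhs
    -- Otherwise the place `l` would be proposed, and the transition there made, after time `n`.
    obtain ⟨m, hm, hfm⟩ := hf (some l) n
    have hαm := hα.mono hm
    obtain ⟨β, hβ⟩ := hextra m (R m) α l hfm ⟨hhs, hαm.1, fun k => by
      obtain ⟨j, hj, h⟩ := hplan k m
      exact h ▸ hαm.2 j hj⟩
    exact Loc.Indep.irrefl l (hα.2 m hm β l hβ)
  · obtain ⟨m, -, h⟩ := hplan k 0
    exact ⟨m, h⟩
  · obtain ⟨s, hs⟩ := htail n
    refine ⟨s, fun k => ?_⟩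
    obtain ⟨m, hm, h⟩ := hplan k n
    exact ⟨m, hm, h.trans (hs k)⟩
  · obtain ⟨s, hs⟩ := htail n
    rcases hcase n (R n) with h | ⟨-, α, l, h1, h2, -⟩
    · exact .inl ⟨s + 0, h.1.trans (hs 0)⟩
    · exact .inr ⟨α, l, h2, h1.1, R n, s, rfl, hs, h1.2.2⟩

/-! ### Reachable states -/

/-- The state `Q` can be reached from `P`. -/
def Reach (D : K → Expr.{u, w, x, v} A K O) : Expr A K O → Expr A K O → Prop :=
  Relation.ReflTransGen fun P Q => ∃ α, Step D P α Q

theorem reach_state (ρ : Run D) (n : ℕ) : Reach D (ρ.state 0) (ρ.state n) := by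
  induction n with
  | zero => exact .refl
  | succ n ih =>
    have := ρ.move n
    generalize ρ.state (n + 1) = R, ρ.act n = o at this ⊢
    cases this with
    | idle => exact ih
    | step h => exact ih.tail ⟨_, h.toStep⟩

theorem Reach.exists_run {P : Expr A K O} {ρ : Run D} (h : Reach D P (ρ.state 0)) :
    ∃ (ρ' : Run D) (n : ℕ), ρ'.state 0 = P ∧ ρ'.drop n = ρ := by
  induction h using Relation.ReflTransGen.head_induction_on with
  | refl => exact ⟨ρ, 0, rfl, by simp [drop]⟩
  | head h _ ih =>
    obtain ⟨α, h⟩ := h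
    obtain ⟨ρ', n, rfl, rfl⟩ := ih
    obtain ⟨l, hl⟩ := h.exists_locStep
    refine ⟨cons _ (some (α, l)) ρ' (.step hl), n + 1, rfl, ?_⟩
    simp [drop, cons, Nat.add_right_comm n 1]

theorem perp_drop {ρ : Run D} {α : Act A O} (h : ρ.Perp α) (k : ℕ) : (ρ.drop k).Perp α := by
  obtain ⟨l, n, h⟩ := h
  have h' := h.mono (Nat.le_add_left n k)
  exact ⟨l, n, h'.1, fun j hj => h'.2 (k + j) (by omega)⟩

/-! ### Schedulers in terms of runs -/

/-- The consequences, in terms of runs, of the four requirements on a fair scheduler that are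
used to refute them. -/
structure IsScheduler (F : Expr.{u, w, x, v} A K O) (D : K → Expr.{u, w, x, v} A K O)
    (r : Fin 2 → Handshake A) (t : Fin 2 → O) : Prop where
  perp : ∀ (i : Fin 2) (ρ : Run D), Reach D F (ρ.state 0) → ρ.IsJust →
    {n | ρ.HasAct (.hs (r i)) n}.Finite → ρ.Perp (.hs (r i))
  served : ∀ (i : Fin 2) (ρ : Run D), Reach D F (ρ.state 0) → ρ.IsJust →
    ∀ n, ρ.HasAct (.hs (r i)) n → ∃ m, n < m ∧ ρ.HasAct (.out (t i)) m
  requested : ∀ (i : Fin 2) (ρ : Run D), ρ.state 0 = F → (∀ n, ¬ ρ.HasAct (.hs (r i)) n) →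
    ∀ n, ¬ ρ.HasAct (.out (t i)) n
  separated : ∀ (i j : Fin 2) (P Q R : Expr A K O), Reach D F P →
    Step D P (.out (t i)) Q → Step D Q (.out (t j)) R → False

/-- The run that makes the first `n` moves of `ρ` only. -/
def truncate (ρ : Run D) (n : ℕ) : Run D where
  state k := ρ.state (min k n)
  act k := if k < n then ρ.act k else none
  move k := by
    by_cases h : k < n
    · rw [min_eq_left h.le, min_eq_left (Nat.succ_le_of_lt h), if_pos h]
      exact ρ.move k
    · rw [min_eq_right (by omega), min_eq_right (by omega), if_neg h]
      exact .idle _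

theorem count_truncate_le (ρ : Run D) (n k : ℕ) : (ρ.truncate n).count k ≤ n := by
  induction k with
  | zero => simp
  | succ k ih =>
    rcases ho : (ρ.truncate n).act k with _ | a
    · rwa [count_succ_of_none ho]
    · rw [count_succ_of_some ho]
      have h1 : k < n := by
        by_contra h
        simp [truncate, h] at ho
      have h2 : (ρ.truncate n).count k ≤ k := Nat.count_le _
      omega

theorem isScheduler_of_paths {F : Expr.{u, w, x, v} A K O} {r : Fin 2 → Handshake A}
    {t : Fin 2 → O} {e : O}
    (h₁ : ∀ (i : Fin 2) (η : Path D), η.IsPathOf F → η.Just →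
      {n | η.OccursAt (.hs (r i)) n}.Finite → η.Enabled (r i))
    (h₂ : ∀ (i : Fin 2) (η : Path D), η.IsPathOf F → η.Just →
      ∀ n, η.OccursAt (.hs (r i)) n → ∃ m, n < m ∧ η.OccursAt (.out (t i)) m)
    (h₃ : ∀ (i : Fin 2) (η : Path D), η.IsPathOf F → η.len ≠ ⊤ →
      {n | η.OccursAt (.out (t i)) n}.ncard ≤ {n | η.OccursAt (.hs (r i)) n}.ncard)
    (h₄ : ∀ (i j : Fin 2) (η : Path D), η.IsPathOf F →
      ∀ p q, p < q → η.OccursAt (.out (t i)) p → η.OccursAt (.out (t j)) q →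
        ∃ m, p < m ∧ m < q ∧ η.OccursAt (.out e) m) : IsScheduler F D r t where
  perp := fun i ρ hρ hj hfin => by
    obtain ⟨ρ', n, h0, rfl⟩ := hρ.exists_run
    have hj' : ρ'.IsJust := fun α h => hj α (perp_drop h n)
    obtain ⟨η, hη⟩ := ρ'.exists_presents
    have hJ := hη.justFor hj'
    refine perp_drop (h₁ i η (hη.state_zero.trans h0) ⟨_, hJ⟩ ?_ _ hJ) n
    refine (((Set.finite_lt_nat n).union (hfin.image (n + ·))).image ρ'.count).subset ?_
    intro k hk
    obtain ⟨m, rfl, l, hm⟩ := hη.exists_hasAct hk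
    refine ⟨m, ?_, rfl⟩
    rcases lt_or_ge m n with h | h
    · exact .inl h
    · refine .inr ⟨m - n, ⟨l, ?_⟩, by simp; omega⟩
      simpa [drop, Nat.add_sub_cancel' h] using hm
  served := fun i ρ hρ hj k ⟨l, hk⟩ => by
    obtain ⟨ρ', n, h0, rfl⟩ := hρ.exists_run
    have hj' : ρ'.IsJust := fun α h => hj α (perp_drop h n)
    obtain ⟨η, hη⟩ := ρ'.exists_presents
    obtain ⟨m, hm, ht⟩ := h₂ i η (hη.state_zero.trans h0) ⟨_, hη.justFor hj'⟩ _
      (hη.occursAt ⟨l, hk⟩)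
    obtain ⟨j, rfl, l', hl'⟩ := hη.exists_hasAct ht
    have hj : n + k < j := by
      by_contra! h
      exact absurd (ρ'.count_mono h) (by omega)
    exact ⟨j - n, by omega, l', by simpa [drop, show n + (j - n) = j by omega] using hl'⟩
  requested := fun i ρ h0 hr n ⟨l, ht⟩ => by
    obtain ⟨η, hη⟩ := (ρ.truncate (n + 1)).exists_presents
    have hle : η.len ≤ (n + 1 : ℕ) := hη.len ▸ iSup_le fun k => by
      exact_mod_cast ρ.count_truncate_le (n + 1) k
    have hcard := h₃ i η (hη.state_zero.trans (by simpa [truncate] using h0))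
      (ne_top_of_le_ne_top (ENat.natCast_ne_top _) hle)
    have hempty : {n | η.OccursAt (.hs (r i)) n} = ∅ := by
      rw [Set.eq_empty_iff_forall_notMem]
      intro k hk
      obtain ⟨m, -, l', hm⟩ := hη.exists_hasAct hk
      simp only [truncate] at hm
      split_ifs at hm
      exact hr m ⟨l', hm⟩
    have hfin : {n | η.OccursAt (.out (t i)) n}.Finite := (Set.finite_lt_nat (n + 1)).subset
      fun k hk => by exact_mod_cast hk.1.trans_le hle
    rw [hempty, Set.ncard_empty, Nat.le_zero, Set.ncard_eq_zero hfin] at hcard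
    have : (ρ.truncate (n + 1)).HasAct (.out (t i)) n := ⟨l, by simpa [truncate] using ht⟩
    exact (Set.eq_empty_iff_forall_notMem.mp hcard) _ (hη.occursAt this)
  separated := fun i j P Q R hP hQ hR => by
    obtain ⟨l, hl⟩ := hQ.exists_locStep
    obtain ⟨m, hm⟩ := hR.exists_locStep
    let σ : Run D := cons P _ (cons Q _ (idle R) (.step hm)) (.step hl)
    obtain ⟨ρ, n, h0, hn⟩ := Reach.exists_run (ρ := σ) hP
    obtain ⟨η, hη⟩ := ρ.exists_presents
    have ha : ρ.act n = some (.out (t i), l) := congrFun (congrArg Run.act hn) 0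
    have hb : ρ.act (n + 1) = some (.out (t j), m) := congrFun (congrArg Run.act hn) 1
    have hc := count_succ_of_some ha
    obtain ⟨k, h1, h2, -⟩ := h₄ i j η (hη.state_zero.trans h0) _ _ (by omega)
      (hη.occursAt ⟨l, ha⟩) (hη.occursAt ⟨m, hb⟩)
    omega

/-! ### There is no fair scheduler -/

namespace IsScheduler

variable {F : Expr.{u, w, x, v} A K O} {r : Fin 2 → Handshake A} {t : Fin 2 → O}

/-- The handshake `c` is possible after `n` transitions that are not handshakes. -/
def PossibleIn (D : K → Expr.{u, w, x, v} A K O) (c : Handshake A) : ℕ → Expr A K O → Prop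
  | 0, P => ∃ Q, Step D P (.hs c) Q
  | n + 1, P => ∃ α Q, (∀ d, α ≠ .hs d) ∧ Step D P α Q ∧ PossibleIn D c n Q

/-- When no handshake is made any more, each `r i` becomes perpetually enabled. -/
theorem exists_possibleIn (h : IsScheduler F D r t) (i : Fin 2) {P : Expr A K O}
    (hP : Reach D F P) : ∃ n, PossibleIn D (r i) n P := by
  obtain ⟨ζ, h0, hj, -, -, hact⟩ := exists_just_interleaving (idle (D := D) P)
  replace h0 : ζ.state 0 = P := h0
  have hhs : ∀ n c, ¬ ζ.HasAct (.hs c) n := by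
    rintro n c ⟨l, hl⟩
    rcases hact n with ⟨k, hk⟩ | ⟨α, l', hα, hne, -⟩
    · rw [hl] at hk
      cases hk
    · rw [hl] at hα
      cases hα
      exact hne c rfl
  obtain ⟨l, n, ⟨Q, hQ⟩, -⟩ := h.perp i ζ (h0 ▸ hP) hj (by simp [hhs])
  suffices ∀ k, k ≤ n → ∃ m, PossibleIn D (r i) m (ζ.state (n - k)) by
    simpa [h0] using this n le_rfl
  intro k
  induction k with
  | zero => exact fun _ => ⟨0, Q, hQ.toStep⟩
  | succ k ih =>
    intro hk
    obtain ⟨m, hm⟩ := ih (by omega)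
    rw [show n - k = n - (k + 1) + 1 by omega] at hm
    rcases ho : ζ.act (n - (k + 1)) with _ | ⟨α, l'⟩
    · exact ⟨m, state_succ_of_none ho ▸ hm⟩
    · exact ⟨m + 1, α, _, fun d hd => hhs _ d ⟨l', hd ▸ ho⟩, (locStep_of_some ho).toStep, hm⟩

/-- There is a run in which `r 1` happens infinitely often, but no other handshake. -/
theorem exists_run_infinitely_often (h : IsScheduler F D r t) : ∃ ρ : Run D, ρ.state 0 = F ∧
    (∀ n c, ρ.HasAct (.hs c) n → c = r 1) ∧ ∀ n, ∃ m, n ≤ m ∧ ρ.HasAct (.hs (r 1)) m := by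
  let S := {p : ℕ × Expr A K O // Reach D F p.2 ∧ PossibleIn D (r 1) p.1 p.2}
  have key : ∀ p : S, ∃ (o : Option (Act A O × Loc)) (q : S), Move D p.1.2 o q.1.2 ∧
      (∀ c l, o = some (.hs c, l) → c = r 1) ∧
      ((∃ l, o = some (.hs (r 1), l)) ∨ p.1.1 = q.1.1 + 1) := by
    rintro ⟨⟨n, P⟩, hP, hn⟩
    cases n with
    | zero =>
      obtain ⟨Q, hQ⟩ := hn
      have hr : Reach D F Q := hP.tail ⟨_, hQ⟩
      obtain ⟨m, hm⟩ := h.exists_possibleIn 1 hr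
      obtain ⟨l, hl⟩ := hQ.exists_locStep
      refine ⟨some (.hs (r 1), l), ⟨(m, Q), hr, hm⟩, .step hl, fun c l' hc => ?_, .inl ⟨l, rfl⟩⟩
      cases hc
      rfl
    | succ n =>
      obtain ⟨α, Q, hα, hQ, hn⟩ := hn
      obtain ⟨l, hl⟩ := hQ.exists_locStep
      refine ⟨some (α, l), ⟨(n, Q), hP.tail ⟨_, hQ⟩, hn⟩, .step hl, fun c l' hc => ?_, .inr rfl⟩
      cases hc
      exact (hα c rfl).elim
  choose o next hmove hhs hr using key
  obtain ⟨n₀, hn₀⟩ := h.exists_possibleIn 1 (P := F) .refl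
  let s : ℕ → S := fun n => Nat.rec ⟨(n₀, F), .refl, hn₀⟩ (fun _ => next) n
  refine ⟨⟨fun n => (s n).1.2, fun n => o (s n), fun n => hmove (s n)⟩, rfl,
    fun n c ⟨l, hl⟩ => hhs (s n) c l hl, ?_⟩
  suffices ∀ k n, (s n).1.1 = k → ∃ m, n ≤ m ∧ ∃ l, o (s m) = some (.hs (r 1), l) from
    fun n => this _ n rfl
  intro k
  induction k with
  | zero =>
    intro n hn
    exact ⟨n, le_rfl, (hr (s n)).resolve_right (by omega)⟩
  | succ k ih =>
    intro n hn
    rcases hr (s n) with h | h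
    · exact ⟨n, le_rfl, h⟩
    · obtain ⟨m, hm, h⟩ := ih (n + 1) (by change (next (s n)).1.1 = k; omega)
      exact ⟨m, by omega, h⟩

theorem false (h : IsScheduler F D r t) (hr : r 0 ≠ r 1) : False := by
  obtain ⟨ρ, hρ0, hρhs, hρr⟩ := h.exists_run_infinitely_often
  obtain ⟨η, hη0, hηj, -, hηrec, hηact⟩ := ρ.exists_just_interleaving
  rw [hρ0] at hη0
  have hηr0 : ∀ n, ¬ η.HasAct (.hs (r 0)) n := by
    rintro n ⟨l, hl⟩
    rcases hηact n with ⟨k, hk⟩ | ⟨α, l', hα, hne, -⟩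
    · exact hr (hρhs k _ ⟨l, hk ▸ hl⟩)
    · rw [hl] at hα
      cases hα
      exact hne _ rfl
  have hηt0 := h.requested 0 η hη0 hηr0
  have hηt1 : ∀ n, ∃ m, n ≤ m ∧ η.HasAct (.out (t 1)) m := by
    intro n
    obtain ⟨s, hs⟩ := hηrec n
    obtain ⟨k, hk, l, hl⟩ := hρr s
    obtain ⟨m, hm, hm'⟩ := hs (k - s)
    rw [Nat.add_sub_cancel' hk, hl] at hm'
    obtain ⟨j, hj, hj'⟩ := h.served 1 η (hη0 ▸ .refl) hηj m ⟨l, hm'⟩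
    exact ⟨j, by omega, hj'⟩
  have hreach : ∀ n, Reach D F (η.state n) := fun n => hη0 ▸ η.reach_state n
  obtain ⟨l, n, ⟨P, hP⟩, hl⟩ := h.perp 0 η (hη0 ▸ .refl) hηj (by simp [hηr0])
  -- From the `n`-th state on, `η` ignores the component that offers `r 0`. So `r 0` can be made
  -- there, with the rest of `η` continuing as before, and `t 0` has to come.
  obtain ⟨σ, hσ0, hσ⟩ := (η.drop n).exists_residual (l := l) (α := .hs (r 0)) (P := P)
    (by simpa [drop] using hP) (fun k => hl (n + k) (by omega))
  have hmove : Move D (η.state n) (some (.hs (r 0), l)) (σ.state 0) := hσ0 ▸ .step hP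
  obtain ⟨ζ, hζ0, hζj, hζall, -, hζact⟩ := (cons _ _ σ hmove).exists_just_interleaving
  have hζreach : Reach D F (ζ.state 0) := hζ0 ▸ hreach n
  obtain ⟨m₀, hm₀⟩ := hζall 0
  obtain ⟨m, -, l', hm⟩ := h.served 0 ζ hζreach hζj m₀ ⟨l, hm₀⟩
  rcases hζact m with ⟨k, hk⟩ | ⟨α, l'', hα, -, R, s, hR0, hR, hfree⟩
  · rw [hm] at hk
    cases k with
    | zero => cases hk
    | succ k => exact hηt0 (n + k) ⟨l', by rw [hk]; exact (congrFun hσ k).symm⟩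
  · -- The transition `t 0` is independent of the rest of `η`, so it can be postponed until just
    -- before the next `t 1`.
    rw [hm] at hα
    cases hα
    have hRreach : ∀ q, Reach D F (R.state q) := fun q =>
      hζreach.trans ((ζ.reach_state m).trans (hR0 ▸ R.reach_state q))
    obtain ⟨q, l₁, hq⟩ : ∃ q, R.HasAct (.out (t 1)) q := by
      obtain ⟨p, hp, l₁, hl₁⟩ := hηt1 (n + s)
      refine ⟨p - (n + s) + 1, l₁, ?_⟩
      rw [hR, ← hl₁, show p = n + (s + (p - (n + s))) by omega]
      rw [show n + (s + (p - (n + s))) - (n + s) = p - (n + s) by omega]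
      exact congrFun hσ (s + (p - (n + s)))
    obtain ⟨U, hU⟩ := (PerpAt.mono (ρ := R) (α := .out (t 0)) (l := l')
      ⟨⟨_, hR0 ▸ locStep_of_some hm⟩, fun k _ => hfree k⟩ (Nat.zero_le q)).1
    obtain ⟨V, hV, -⟩ := hU.diamond (locStep_of_some hq) (hfree q _ _ hq)
    exact h.separated 0 1 _ _ _ (hRreach q) hU.toStep hV.toStep

end IsScheduler

end Run
end CCS

theorem theorem1 {A : Type u} {K : Type w} {O : Type x}
    (D : K → CCS.Expr.{u, w, x, v} A K O)
    (r : Fin 2 → CCS.Handshake A) (t : Fin 2 → O) (e : O) (hr : r 0 ≠ r 1) :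
    ¬ ∃ F : CCS.Expr.{u, w, x, v} A K O,
      (∀ (i : Fin 2) (η : CCS.Path D), η.IsPathOf F → η.Just →
        {n | η.OccursAt (.hs (r i)) n}.Finite → η.Enabled (r i)) ∧
      (∀ (i : Fin 2) (η : CCS.Path D), η.IsPathOf F → η.Just →
        ∀ n, η.OccursAt (.hs (r i)) n → ∃ m, n < m ∧ η.OccursAt (.out (t i)) m) ∧
      (∀ (i : Fin 2) (η : CCS.Path D), η.IsPathOf F → η.len ≠ ⊤ →
        {n | η.OccursAt (.out (t i)) n}.ncard ≤ {n | η.OccursAt (.hs (r i)) n}.ncard) ∧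
      (∀ (i j : Fin 2) (η : CCS.Path D), η.IsPathOf F →
        ∀ p q, p < q → η.OccursAt (.out (t i)) p → η.OccursAt (.out (t j)) q →
          ∃ m, p < m ∧ m < q ∧ η.OccursAt (.out e) m) := by
  rintro ⟨F, h₁, h₂, h₃, h₄⟩
  exact (CCS.Run.isScheduler_of_paths h₁ h₂ h₃ h₄).false hr
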